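/- **Setting (distributed game).** Let $T>0$, $N\in\mathbb N$, $(n_i)_{i\le N},(k_i)_{i\le N}\subset\mathbb N$, $I_N=\{1,\dots,N\}$, $n_x=\sum_i n_i$, $n_a=\sum_i k_i$. Write $x=(x_i)_{i}\in\prod_i\mathbb R^{n_i}=\mathbb R^{n_x}$, $a=(a_i)_i\in\prod_i\mathbb R^{k_i}=\mathbb R^{n_a}$, $x_{-i}=(x_j)_{j\ne i}$, $a_{-i}=(a_j)_{j\neq i}$. For each agent $i$ let $A_i\subset\mathbb R^{k_i}$ be Borel, let $(b_i,\sigma_i):[0,T]\times\mathbb R^{n_i}\times\mathbb R^{k_i}\to\mathbb R^{n_i}\times\mathbb R^{n_i\times n_w}$ be measurable, and let $f_i:[0,T]\times\mathbb R^{n_x}\times\mathbb R^{n_a}\to\mathbb R$ and $g_i:\mathbb R^{n_x}\to\mathbb R$ be measurable with $$\sup_{t,x,a}\frac{|f_i(t,x,a)|+|g_i(x)|}{1+|x|^2+|a|^2}<\infty .$$ Let $W$ be an $n_w$-dimensional Brownian motion on a probability space $(\Omega,\mathcal F,\mathbb P)$. The policy class $\pi_i$ of agent $i$ is the set of all measurable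 $\phi_i:[0,T]\times\mathbb R^{n_i}\to A_i$ with $\sup_{t,x_i}|\phi_i(t,x_i)|/(1+|x_i|)<\infty$ such that for every $(t,x_i)\in[0,T]\times\mathbb R^{n_i}$ the equation $$dX^i_s=b_i(s,X^i_s,\phi_i(s,X^i_s))\,ds+\sigma_i(s,X^i_s,\phi_i(s,X^i_s))\,dW_s,\quad s\in[t,T];\qquad X^i_t=x_i,$$ has a weak solution $X^{t,x_i,\phi_i}$ on $(\Omega,\mathcal F,\mathbb P)$, driven by $W$, with $\mathbb E\big[\sup_{s\in[t,T]}|X^{t,x_i,\phi_i}_s|^2\big]<\infty$, which is unique in law among such square-integrable weak solutions. Fix such solutions $X^{t,x_i,\phi_i}$ for all $i$, $\phi_i\in\pi_i$ and $(t,x_i)$. For $\phi=(\phi_i)_i\in\pi:=\prod_i\pi_i$ put $X^{t,x,\phi}=(X^{t,x_i,\phi_i})_{i}$ and $\alpha^{t,x,\phi}=(\phi_i(\cdot,X^{t,x_i,\phi_i}))_{i}$. The value function of agent $i$ is $$V_i^{t,x}(\phi)=\mathbb E\Big[\int_t^T f_i(s,X^{t,x,\phi}_s,\alpha^{t,x,\phi}_s)\,ds+g_i(X^{t,x,\phi}_T)\Big].$$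 A function $\Phi:[0,T]\times\mathbb R^{n_x}\times\pi\to\mathbb R$ is a potential function if $\Phi^{t,x}((\phi_i',\phi_{-i}))-\Phi^{t,x}((\phi_i,\phi_{-i}))=V_i^{t,x}((\phi_i',\phi_{-i}))-V_i^{t,x}((\phi_i,\phi_{-i}))$ for all $(t,x)$, all $i$, all $\phi_i,\phi_i'\in\pi_i$ and all $\phi_{-i}\in\prod_{j\ne i}\pi_j$. The game is a Markov potential game (MPG) if it has a potential function. **Theorem.** Suppose that for all $i\in I_N$ and $t\in[0,T]$ the maps $(x,a)\mapsto f_i(t,x,a)$ and $x\mapsto g_i(x)$ are twice continuously differentiable; that for all $i\in I_N$ $$\sup_{t,x,a}\frac{|\partial_{(x_i,a_i)}f_i(t,x,a)|+|\partial_{x_i}g_i(x)|}{1+|x|+|a|}<\infty ;$$ and that for all $i,j\in I_N$, everywhere, $$\begin{pmatrix}\partial_{x_ix_j}f_i&\partial_{a_ix_j}f_i\\ \partial_{x_ia_j}f_i&\partial_{a_ia_j}f_i\end{pmatrix}=\begin{pmatrix}\partial_{x_ix_j}f_j&\partial_{a_ix_j}f_j\\ \partial_{x_ia_j}f_j&\partial_{a_ia_j}f_j\end{pmatrix},\qquad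 \partial_{x_ix_j}g_i=\partial_{x_ix_j}g_j .$$ Let $(\hat x,\hat a)\in\mathbb R^{n_x}\times\mathbb R^{n_a}$ be arbitrary and define $$F(t,x,a)=\sum_{i=1}^N\int_0^1\begin{pmatrix}\partial_{x_i}f_i\\ \partial_{a_i}f_i\end{pmatrix}\big(t,\hat x+r(x-\hat x),\hat a+r(a-\hat a)\big)^{\!\top}\begin{pmatrix}x_i-\hat x_i\\ a_i-\hat a_i\end{pmatrix}dr,$$ $$G(x)=\sum_{i=1}^N\int_0^1(\partial_{x_i}g_i)\big(\hat x+r(x-\hat x)\big)^\top(x_i-\hat x_i)\,dr .$$ Then: 1. $F$ and $G$ are measurable, and there are measurable functions $U_{f_i}:[0,T]\times\prod_{j\ne i}\mathbb R^{n_j}\times\prod_{j\neq i}\mathbb R^{k_j}\to\mathbb R$ and $U_{g_i}:\prod_{j\ne i}\mathbb R^{n_j}\to\mathbb R$, $i\in I_N$, such that for all $i,t,x,a$ $$f_i(t,x,a)=F(t,x,a)+U_{f_i}(t,x_{-i},a_{-i}),\qquad g_i(x)=G(x)+U_{g_i}(x_{-i}).$$ 2. For all $(t,x)$ and $\phi\in\pi$,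 the random variables $f_i(s,X^{t,x,\phi}_s,\alpha^{t,x,\phi}_s)$, $i\in I_N$, and $F(s,X^{t,x,\phi}_s,\alpha^{t,x,\phi}_s)$ are integrable on $\Omega\times[t,T]$ with respect to $\mathbb P\otimes ds$, and $g_i(X^{t,x,\phi}_T)$ and $G(X^{t,x,\phi}_T)$ are $\mathbb P$-integrable. 3. The function $$\Phi^{t,x}(\phi)=\mathbb E\Big[\int_t^T F(s,X^{t,x,\phi}_s,\alpha^{t,x,\phi}_s)\,ds+G(X^{t,x,\phi}_T)\Big]$$ is a potential function of the distributed game; in particular the game is an MPG. -/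

import Mathlib

open MeasureTheory ProbabilityTheory Filter Topology
open scoped ENNReal

noncomputable section

namespace DistGame

/-- The Euclidean space `ℝ^d`. -/
abbrev Vec (d : ℕ) : Type := EuclideanSpace ℝ (Fin d)

/-- The time interval `[0,T]`. -/
abbrev Time (T : ℝ) : Type := Set.Icc (0 : ℝ) T

/-- Lebesgue measure on `[0,T]`. -/
def timeMeasure (T : ℝ) : Measure (Time T) := Measure.comap Subtype.val volume

/-! ### Potential functions and Markov potential games -/

section Potential

variable {ι S : Type*} {π : ι → Type*} [DecidableEq ι]

/-- `Φ` is a potential function, simultaneously for all initial states: a unilateral deviation of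
any agent changes `Φ` by exactly as much as it changes that agent's value. -/
def IsPotentialFunction (V : ι → S → (∀ i, π i) → ℝ) (Φ : S → (∀ i, π i) → ℝ) : Prop :=
  ∀ (s : S) (i : ι) (φ : ∀ j, π j) (ψ : π i),
    Φ s (Function.update φ i ψ) - Φ s φ = V i s (Function.update φ i ψ) - V i s φ

/-- A game with state space `S`, policy classes `π i` and value functions `V i` is a Markov
potential game if it has a potential function. -/
def IsMarkovPotentialGame (V : ι → S → (∀ i, π i) → ℝ) : Prop :=
  ∃ Φ : S → (∀ i, π i) → ℝ, IsPotentialFunction V Φ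

end Potential

/-! ### Brownian motion, the Itô integral, and weak solutions of SDEs -/

section SDE

variable {T : ℝ} {Ω : Type*} {mΩ : MeasurableSpace Ω} {m nw : ℕ}

/-- `W` is an `nw`-dimensional Brownian motion on `[0,T]` relative to the filtration `𝔽`. -/
structure IsBrownianMotion (P : Measure Ω) (𝔽 : Filtration (Time T) mΩ)
    (W : Time T → Ω → Vec nw) : Prop where
  adapted : ∀ s, Measurable[𝔽 s] (W s)
  zero : ∀ s : Time T, (s : ℝ) = 0 → ∀ᵐ ω ∂P, W s ω = 0
  continuous : ∀ᵐ ω ∂P, Continuous fun s => W s ω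
  increment_law : ∀ u v : Time T, u ≤ v →
    P.map (fun ω => WithLp.ofLp (W v ω - W u ω))
      = Measure.pi (fun _ : Fin nw => gaussianReal 0 (Real.toNNReal ((v : ℝ) - (u : ℝ))))
  increment_indep : ∀ u v : Time T, u ≤ v →
    Indep (MeasurableSpace.comap (fun ω => W v ω - W u ω) inferInstance) (𝔽 u) P

/-- Product of a matrix with a Euclidean vector. -/
def matVec (A : Matrix (Fin m) (Fin nw) ℝ) (v : Vec nw) : Vec m :=
  WithLp.toLp 2 (A.mulVec (WithLp.ofLp v))

/-- A bounded, matrix-valued simple process on `(t,T]`, namely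
`∑ j < steps, ξ j * 1_{(τ j, τ (j+1)]}` with `ξ j` measurable with respect to `𝔽 (τ j)`. -/
structure SimpleProcess (𝔽 : Filtration (Time T) mΩ) (t : Time T) (m nw : ℕ) where
  steps : ℕ
  τ : ℕ → Time T
  τ_mono : Monotone τ
  le_τ : ∀ j, t ≤ τ j
  ξ : ℕ → Ω → Matrix (Fin m) (Fin nw) ℝ
  ξ_measurable : ∀ j p q, Measurable[𝔽 (τ j)] fun ω => ξ j ω p q
  ξ_bounded : ∃ C : ℝ, ∀ j ω p q, |ξ j ω p q| ≤ C

/-- The value of a simple process at time `s`. -/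
def SimpleProcess.eval {𝔽 : Filtration (Time T) mΩ} {t : Time T} (H : SimpleProcess 𝔽 t m nw)
    (s : Time T) (ω : Ω) : Matrix (Fin m) (Fin nw) ℝ :=
  ∑ j ∈ Finset.range H.steps, if H.τ j < s ∧ s ≤ H.τ (j + 1) then H.ξ j ω else 0

/-- The elementary stochastic integral `∫_t^s H dW`. -/
def SimpleProcess.integral {𝔽 : Filtration (Time T) mΩ} {t : Time T} (H : SimpleProcess 𝔽 t m nw)
    (W : Time T → Ω → Vec nw) (s : Time T) (ω : Ω) : Vec m :=
  ∑ j ∈ Finset.range H.steps,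
    matVec (H.ξ j ω) (W (min (H.τ (j + 1)) s) ω - W (min (H.τ j) s) ω)

/-- `M` is (a continuous version of) the Itô integral `s ↦ ∫_t^s K dW`, `s ∈ [t,T]`: the integrand
`K` is almost surely square-integrable in time and is the limit, in probability for the distance of
`L²([t,T])`, of simple processes whose elementary integrals converge to `M` in probability. -/
def IsItoIntegral (P : Measure Ω) (𝔽 : Filtration (Time T) mΩ) (W : Time T → Ω → Vec nw)
    (t : Time T) (K : Time T → Ω → Matrix (Fin m) (Fin nw) ℝ) (M : Time T → Ω → Vec m) : Prop :=
  (∀ᵐ ω ∂P, ContinuousOn (fun s => M s ω) (Set.Ici t)) ∧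
  (∀ᵐ ω ∂P, ∫⁻ s in Set.Ici t, ∑ p, ∑ q, ‖K s ω p q‖ₑ ^ 2 ∂(timeMeasure T) < ∞) ∧
  ∃ H : ℕ → SimpleProcess 𝔽 t m nw,
    (∀ ε : ℝ≥0∞, 0 < ε → Tendsto (fun l => P {ω | ε ≤ ∫⁻ s in Set.Ici t,
        ∑ p, ∑ q, ‖(H l).eval s ω p q - K s ω p q‖ₑ ^ 2 ∂(timeMeasure T)}) atTop (𝓝 0)) ∧
    ∀ s, t ≤ s → TendstoInMeasure P (fun l => (H l).integral W s) atTop (M s)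

/-- On the probability space `(Ω, P)` with Brownian motion `W`, the process `X` is a weak solution on
`[t,T]` of `dX_s = β(s,X_s) ds + ς(s,X_s) dW_s`, `X_t = x`: for some filtration for which `W` is a
Brownian motion, `X` is continuous, adapted and satisfies the integral equation.
Only the values `X s` with `s ≥ t` matter. -/
def IsWeakSolution (P : Measure Ω) (W : Time T → Ω → Vec nw)
    (β : Time T → Vec m → Vec m) (ς : Time T → Vec m → Matrix (Fin m) (Fin nw) ℝ)
    (t : Time T) (x : Vec m) (X : Time T → Ω → Vec m) : Prop :=
  ∃ 𝔽 : Filtration (Time T) mΩ,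
    IsBrownianMotion P 𝔽 W ∧
    (∀ s, t ≤ s → Measurable[𝔽 s] (X s)) ∧
    (∀ ω, ContinuousOn (fun s => X s ω) (Set.Ici t)) ∧
    (∀ᵐ ω ∂P, IntegrableOn (fun r => β r (X r ω)) (Set.Ici t) (timeMeasure T)) ∧
    ∃ M : Time T → Ω → Vec m,
      IsItoIntegral P 𝔽 W t (fun r ω => ς r (X r ω)) M ∧
      ∀ᵐ ω ∂P, ∀ s, t ≤ s →
        X s ω = x + (∫ r in Set.Icc t s, β r (X r ω) ∂(timeMeasure T)) + M s ω

/-- A weak solution with `E[sup_{s ∈ [t,T]} |X_s|²] < ∞`. -/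
def IsSqIntWeakSolution (P : Measure Ω) (W : Time T → Ω → Vec nw)
    (β : Time T → Vec m → Vec m) (ς : Time T → Vec m → Matrix (Fin m) (Fin nw) ℝ)
    (t : Time T) (x : Vec m) (X : Time T → Ω → Vec m) : Prop :=
  IsWeakSolution P W β ς t x X ∧
    ∫⁻ ω, ⨆ s : Set.Ici t, ‖X (s : Time T) ω‖ₑ ^ 2 ∂P < ∞

/-- The law of `(X_s)_{s ∈ [t,T]}` on path space (with the cylinder σ-algebra). -/
def pathLaw (P : Measure Ω) (t : Time T) (X : Time T → Ω → Vec m) :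
    Measure (Set.Ici t → Vec m) :=
  P.map fun ω s => X s ω

end SDE

/-! ### The distributed game -/

/-- The data of a distributed game: horizon `T`, `N` agents, state dimensions `n i`, action
dimensions `k i`, Brownian dimension `nw`, Borel action sets, measurable coefficients, and
measurable costs of at most quadratic growth. -/
structure DistributedGame (N nw : ℕ) (n k : Fin N → ℕ) (T : ℝ) where
  T_pos : 0 < T
  A : ∀ i, Set (Vec (k i))
  A_borel : ∀ i, MeasurableSet (A i)
  b : ∀ i, Time T → Vec (n i) → Vec (k i) → Vec (n i)
  b_measurable : ∀ i, Measurable fun p : Time T × Vec (n i) × Vec (k i) => b i p.1 p.2.1 p.2.2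
  σ : ∀ i, Time T → Vec (n i) → Vec (k i) → Matrix (Fin (n i)) (Fin nw) ℝ
  σ_measurable : ∀ i p q,
    Measurable fun z : Time T × Vec (n i) × Vec (k i) => σ i z.1 z.2.1 z.2.2 p q
  f : Fin N → Time T → (∀ j, Vec (n j)) → (∀ j, Vec (k j)) → ℝ
  f_measurable : ∀ i,
    Measurable fun p : Time T × (∀ j, Vec (n j)) × (∀ j, Vec (k j)) => f i p.1 p.2.1 p.2.2
  g : Fin N → (∀ j, Vec (n j)) → ℝ
  g_measurable : ∀ i, Measurable (g i)
  cost_growth : ∀ i, ∃ C : ℝ, ∀ t x a,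
    |f i t x a| + |g i x| ≤ C * (1 + ‖x‖ ^ 2 + ‖a‖ ^ 2)

namespace DistributedGame

universe u

variable {N nw : ℕ} {n k : Fin N → ℕ} {T : ℝ}

/-- The terminal time `T`, as a point of `[0,T]`. -/
def terminal (D : DistributedGame N nw n k T) : Time T := ⟨T, D.T_pos.le, le_rfl⟩

/-- Agent `i`'s state equation under the distributed policy `φ`: `X` is a square-integrable weak
solution, started from `x` at time `t`, on `(Ω, P)` with Brownian motion `W`. -/
def SolvesState (D : DistributedGame N nw n k T) {Ω : Type u} [MeasurableSpace Ω] (P : Measure Ω)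
    (W : Time T → Ω → Vec nw) (i : Fin N) (φ : Time T → Vec (n i) → Vec (k i))
    (t : Time T) (x : Vec (n i)) (X : Time T → Ω → Vec (n i)) : Prop :=
  IsSqIntWeakSolution P W (fun s y => D.b i s y (φ s y)) (fun s y => D.σ i s y (φ s y)) t x X

/-- Agent `i`'s admissible distributed policies: measurable feedback maps `[0,T] × ℝ^{n_i} → A_i` of
linear growth for which, from each initial time and state, the state equation has a
square-integrable weak solution on `(Ω, P, W)`, unique in law among the square-integrable weak
solutions on all probability spaces with a Brownian motion. -/
structure IsAdmissible (D : DistributedGame N nw n k T) {Ω : Type u} [MeasurableSpace Ω]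
    (P : Measure Ω) (W : Time T → Ω → Vec nw) (i : Fin N)
    (φ : Time T → Vec (n i) → Vec (k i)) : Prop where
  mem : ∀ t x, φ t x ∈ D.A i
  measurable : Measurable fun p : Time T × Vec (n i) => φ p.1 p.2
  growth : ∃ C : ℝ, ∀ t x, ‖φ t x‖ ≤ C * (1 + ‖x‖)
  existence : ∀ t x, ∃ X : Time T → Ω → Vec (n i), D.SolvesState P W i φ t x X
  uniqueness : ∀ t x (X : Time T → Ω → Vec (n i)), D.SolvesState P W i φ t x X →
    ∀ (Ω' : Type u) [MeasurableSpace Ω'] (P' : Measure Ω') [IsProbabilityMeasure P']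
      (W' : Time T → Ω' → Vec nw) (X' : Time T → Ω' → Vec (n i)),
      D.SolvesState P' W' i φ t x X' → pathLaw P t X = pathLaw P' t X'

/-- The set of admissible distributed policies of agent `i`. -/
def Policy (D : DistributedGame N nw n k T) {Ω : Type u} [MeasurableSpace Ω]
    (P : Measure Ω) (W : Time T → Ω → Vec nw) (i : Fin N) : Type :=
  {φ : Time T → Vec (n i) → Vec (k i) // D.IsAdmissible P W i φ}

variable (D : DistributedGame N nw n k T) {Ω : Type u} [MeasurableSpace Ω]
  {P : Measure Ω} {W : Time T → Ω → Vec nw}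

/-- The solution processes `X^{t,x_i,φ_i}` on `(Ω, P, W)` attached to the admissible policies. -/
structure StateProcesses (P : Measure Ω) (W : Time T → Ω → Vec nw) where
  X : ∀ i, D.Policy P W i → Time T → Vec (n i) → Time T → Ω → Vec (n i)
  solves : ∀ i (φ : D.Policy P W i) t x, D.SolvesState P W i φ.1 t x (X i φ t x)

/-- Solution processes always exist, by the definition of admissibility. -/
theorem nonempty_stateProcesses (P : Measure Ω) (W : Time T → Ω → Vec nw) :
    Nonempty (D.StateProcesses P W) :=
  ⟨⟨fun _ φ t x => (φ.2.existence t x).choose, fun _ φ t x => (φ.2.existence t x).choose_spec⟩⟩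

variable {D}

/-- The joint state process `X^{t,x,φ}`, for `s = (t,x)`. -/
def StateProcesses.state (𝒳 : D.StateProcesses P W) (s : Time T × (∀ j, Vec (n j)))
    (φ : ∀ j, D.Policy P W j) (r : Time T) (ω : Ω) : ∀ j, Vec (n j) :=
  fun j => 𝒳.X j (φ j) s.1 (s.2 j) r ω

/-- The joint control process `α^{t,x,φ}`, for `s = (t,x)`. -/
def StateProcesses.control (𝒳 : D.StateProcesses P W) (s : Time T × (∀ j, Vec (n j)))
    (φ : ∀ j, D.Policy P W j) (r : Time T) (ω : Ω) : ∀ j, Vec (k j) :=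
  fun j => (φ j).1 r (𝒳.X j (φ j) s.1 (s.2 j) r ω)

/-- `E[∫_t^T h(r, X_r, α_r) dr + q(X_T)]` for `X = X^{t,x,φ}`, `α = α^{t,x,φ}` and `s = (t,x)`. -/
def StateProcesses.expectedCost (𝒳 : D.StateProcesses P W)
    (h : Time T → (∀ j, Vec (n j)) → (∀ j, Vec (k j)) → ℝ) (q : (∀ j, Vec (n j)) → ℝ)
    (s : Time T × (∀ j, Vec (n j))) (φ : ∀ j, D.Policy P W j) : ℝ :=
  ∫ ω, ((∫ r in Set.Ici s.1, h r (𝒳.state s φ r ω) (𝒳.control s φ r ω) ∂(timeMeasure T))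
    + q (𝒳.state s φ D.terminal ω)) ∂P

/-- The running and terminal costs are integrable along `X^{t,x,φ}`, so that `expectedCost` is a
genuine expectation. -/
def StateProcesses.IntegrableCost (𝒳 : D.StateProcesses P W)
    (h : Time T → (∀ j, Vec (n j)) → (∀ j, Vec (k j)) → ℝ) (q : (∀ j, Vec (n j)) → ℝ)
    (s : Time T × (∀ j, Vec (n j))) (φ : ∀ j, D.Policy P W j) : Prop :=
  Integrable (fun p : Ω × Time T => h p.2 (𝒳.state s φ p.2 p.1) (𝒳.control s φ p.2 p.1))
      (P.prod ((timeMeasure T).restrict (Set.Ici s.1))) ∧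
    Integrable (fun ω => q (𝒳.state s φ D.terminal ω)) P

/-- The value function of agent `i`. -/
def StateProcesses.value (𝒳 : D.StateProcesses P W) (i : Fin N)
    (s : Time T × (∀ j, Vec (n j))) (φ : ∀ j, D.Policy P W j) : ℝ :=
  𝒳.expectedCost (D.f i) (D.g i) s φ

end DistributedGame

/-! ### Decomposition of the costs and partial derivatives -/

section Calculus

variable {N : ℕ} {d : Fin N → ℕ}

/-- The profile `x_{-i}`. -/
def others (i : Fin N) (x : ∀ j, Vec (d j)) : ∀ j : {j : Fin N // j ≠ i}, Vec (d j) :=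
  fun j => x j

/-- The partial gradient `∂_{x_i} h (x)` of a real function of a profile. -/
def partialGrad (i : Fin N) (h : (∀ j, Vec (d j)) → ℝ) (x : ∀ j, Vec (d j)) : Vec (d i) :=
  gradient (fun y => h (Function.update x i y)) (x i)

/-- The partial Jacobian with respect to `x_j` of a vector-valued function of a profile. -/
def partialDeriv {m : ℕ} (j : Fin N) (h : (∀ l, Vec (d l)) → Vec m) (x : ∀ l, Vec (d l)) :
    Vec (d j) →L[ℝ] Vec m :=
  fderiv ℝ (fun y => h (Function.update x j y)) (x j)

variable {n k : Fin N → ℕ}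

/-- The block `∂_{x_i x_j} h`. -/
def hessXX (i j : Fin N) (h : (∀ l, Vec (n l)) → (∀ l, Vec (k l)) → ℝ) (x : ∀ l, Vec (n l))
    (a : ∀ l, Vec (k l)) : Vec (n j) →L[ℝ] Vec (n i) :=
  partialDeriv j (fun y => partialGrad i (fun z => h z a) y) x

/-- The block `∂_{a_i x_j} h`. -/
def hessAX (i j : Fin N) (h : (∀ l, Vec (n l)) → (∀ l, Vec (k l)) → ℝ) (x : ∀ l, Vec (n l))
    (a : ∀ l, Vec (k l)) : Vec (n j) →L[ℝ] Vec (k i) :=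
  partialDeriv j (fun y => partialGrad i (fun c => h y c) a) x

/-- The block `∂_{x_i a_j} h`. -/
def hessXA (i j : Fin N) (h : (∀ l, Vec (n l)) → (∀ l, Vec (k l)) → ℝ) (x : ∀ l, Vec (n l))
    (a : ∀ l, Vec (k l)) : Vec (k j) →L[ℝ] Vec (n i) :=
  partialDeriv j (fun c => partialGrad i (fun z => h z c) x) a

/-- The block `∂_{a_i a_j} h`. -/
def hessAA (i j : Fin N) (h : (∀ l, Vec (n l)) → (∀ l, Vec (k l)) → ℝ) (x : ∀ l, Vec (n l))
    (a : ∀ l, Vec (k l)) : Vec (k j) →L[ℝ] Vec (k i) :=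
  partialDeriv j (fun c => partialGrad i (fun e => h x e) c) a

end Calculus

namespace DistributedGame

variable {N nw : ℕ} {n k : Fin N → ℕ} {T : ℝ} (D : DistributedGame N nw n k T)

/-- Measurable `F`, `G` decompose the costs: for suitable measurable `U_{f_i}`, `U_{g_i}` and all `i`,
`f_i(t,x,a) = F(t,x,a) + U_{f_i}(t,x_{-i},a_{-i})` and `g_i(x) = G(x) + U_{g_i}(x_{-i})`. -/
def IsCostDecomposition (F : Time T → (∀ j, Vec (n j)) → (∀ j, Vec (k j)) → ℝ)
    (G : (∀ j, Vec (n j)) → ℝ) : Prop :=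
  Measurable (fun p : Time T × (∀ j, Vec (n j)) × (∀ j, Vec (k j)) => F p.1 p.2.1 p.2.2) ∧
  Measurable G ∧
  ∃ (Uf : ∀ i : Fin N, Time T → (∀ j : {j : Fin N // j ≠ i}, Vec (n j)) →
        (∀ j : {j : Fin N // j ≠ i}, Vec (k j)) → ℝ)
    (Ug : ∀ i : Fin N, (∀ j : {j : Fin N // j ≠ i}, Vec (n j)) → ℝ),
    (∀ i, Measurable fun p : Time T × (∀ j : {j : Fin N // j ≠ i}, Vec (n j)) ×
        (∀ j : {j : Fin N // j ≠ i}, Vec (k j)) => Uf i p.1 p.2.1 p.2.2) ∧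
    (∀ i, Measurable (Ug i)) ∧
    (∀ i t x a, D.f i t x a = F t x a + Uf i t (others i x) (others i a)) ∧
    ∀ i x, D.g i x = G x + Ug i (others i x)

/-- The line-integral potential `F` of the running costs, with base point `(x₀, a₀)`. -/
def potentialF (x₀ : ∀ j, Vec (n j)) (a₀ : ∀ j, Vec (k j)) (t : Time T) (x : ∀ j, Vec (n j))
    (a : ∀ j, Vec (k j)) : ℝ :=
  ∑ i, ∫ r in (0 : ℝ)..1,
    (inner ℝ (partialGrad i (fun y => D.f i t y (a₀ + r • (a - a₀))) (x₀ + r • (x - x₀)))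
        (x i - x₀ i)
      + inner ℝ (partialGrad i (fun c => D.f i t (x₀ + r • (x - x₀)) c) (a₀ + r • (a - a₀)))
        (a i - a₀ i))

/-- The line-integral potential `G` of the terminal costs, with base point `x₀`. -/
def potentialG (x₀ : ∀ j, Vec (n j)) (x : ∀ j, Vec (n j)) : ℝ :=
  ∑ i, ∫ r in (0 : ℝ)..1,
    inner ℝ (partialGrad i (D.g i) (x₀ + r • (x - x₀))) (x i - x₀ i)

end DistributedGame

end DistGame

end

/-!
The matrix of derivatives of the 1-form `∑ i, ∂_{(x_i,a_i)} f_i`, the blockwise gradient of the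
costs, has `(i, j)` block `∂_j ∂_i f_i`. The hypothesis replaces `f_i` by `f_j` in this block, and
the symmetry of the second derivative of `f_j` then turns it into the transpose of the `(j, i)`
block: the form is closed. By Poincaré's lemma its integral along segments, which is `F`, is a
primitive (`hasFDerivAt_linePotential`), so `f_i - F` has zero derivative in block `i` and depends
on the other blocks only (`sub_linePotential_eq`). Both costs are instances of one statement about a
complete family of orthogonal projections: onto the pairs `(x_i, a_i)` for `F`, onto the `x_i` for
`G`. No continuity in time is available; `F` is measurable because a derivative is a limit of
difference quotients (`measurable_fderiv_apply_of_measurable`).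

The linear growth of the gradients makes `F` and `G` grow quadratically, the policies grow linearly,
and the state processes have second moments bounded uniformly in time; Tonelli's theorem gives the
integrability of all costs (`StateProcesses.integrableCost_of_growth`). Hence `V_i - Φ` is the
expected cost built from `f_i - F` and `g_i - G`. It involves the states and controls of the agents
`j ≠ i` only, and these do not change when agent `i` deviates, because each agent's equation contains
its own state and policy alone (`StateProcesses.isPotentialFunction_expectedCost`).
-/

noncomputable section

namespace DistGame

/-! ### Line-integral potentials of blockwise closed forms -/

section LinePotential

variable {ι E : Type*} [Fintype ι] [NormedAddCommGroup E] [NormedSpace ℝ E]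

/-- The `1`-form `∑ i, D(h i) ∘ P i`, which collects the derivative of each `h i` in its own
block, the range of the projection `P i`. -/
def blockForm (P : ι → E →L[ℝ] E) (h : ι → E → ℝ) (z : E) : E →L[ℝ] ℝ :=
  ∑ i, (fderiv ℝ (h i) z).comp (P i)

/-- The integral of `blockForm P h` along the segment from `z₀` to `z`. The sum is kept outside the
integral. -/
def linePotential (P : ι → E →L[ℝ] E) (h : ι → E → ℝ) (z₀ z : E) : ℝ :=
  ∑ i, ∫ r in (0 : ℝ)..1, fderiv ℝ (h i) (z₀ + r • (z - z₀)) (P i (z - z₀))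

variable {P : ι → E →L[ℝ] E} {h : ι → E → ℝ}

theorem linePotential_eq_curveIntegral (hh : ∀ i, ContDiff ℝ 2 (h i)) (z₀ z : E) :
    linePotential P h z₀ z = curveIntegral (blockForm P h) (.segment z₀ z) := by
  rw [curveIntegral_segment, linePotential, ← intervalIntegral.integral_finsetSum]
  · refine intervalIntegral.integral_congr fun r _ => ?_
    simp [blockForm, AffineMap.lineMap_apply, add_comm]
  · intro i _
    have := (hh i).continuous_fderiv (by simp)
    exact Continuous.intervalIntegrable (by fun_prop) _ _

theorem hasFDerivAt_blockForm (hh : ∀ i, ContDiff ℝ 2 (h i)) (z : E) :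
    HasFDerivAt (blockForm P h)
      (∑ i, ((ContinuousLinearMap.compL ℝ E E ℝ).flip (P i)).comp
        (fderiv ℝ (fderiv ℝ (h i)) z)) z := by
  have hd (i : ι) : DifferentiableAt ℝ (fderiv ℝ (h i)) z :=
    ((hh i).fderiv_right (m := 1) (by norm_num)).differentiable (by simp) z
  have := HasFDerivAt.fun_sum (u := Finset.univ) fun i _ =>
    ((ContinuousLinearMap.compL ℝ E E ℝ).flip (P i)).hasFDerivAt.comp z (hd i).hasFDerivAt
  exact this

/-- Poincaré's lemma for `blockForm`: if, for all `i` and `j`, the `(j, i)` blocks of the second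
derivatives of `h i` and `h j` coincide, then the form is closed and its line integral is a
primitive. -/
theorem hasFDerivAt_linePotential (hP : CompleteOrthogonalIdempotents P)
    (hh : ∀ i, ContDiff ℝ 2 (h i))
    (hsym : ∀ i j z u v, fderiv ℝ (fderiv ℝ (h i)) z (P j v) (P i u)
      = fderiv ℝ (fderiv ℝ (h j)) z (P j v) (P i u)) (z₀ z : E) :
    HasFDerivAt (linePotential P h z₀) (blockForm P h z) z := by
  have hsum (v : E) : ∑ j, P j v = v := by
    simpa using congrArg (fun L : E →L[ℝ] E => L v) hP.complete
  have hclosed (w u v : E) : ∑ i, fderiv ℝ (fderiv ℝ (h i)) w v (P i u)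
      = ∑ i, fderiv ℝ (fderiv ℝ (h i)) w u (P i v) := by
    have expand (u v : E) : ∑ i, fderiv ℝ (fderiv ℝ (h i)) w v (P i u)
        = ∑ i, ∑ j, fderiv ℝ (fderiv ℝ (h i)) w (P j v) (P i u) := by
      refine Finset.sum_congr rfl fun i _ => ?_
      conv_lhs => rw [← hsum v]
      simp
    rw [expand, expand, Finset.sum_comm]
    refine Finset.sum_congr rfl fun j _ => Finset.sum_congr rfl fun i _ => ?_
    rw [hsym]
    exact (hh j).contDiffAt.isSymmSndFDerivAt (by simp) _ _
  have key := convex_univ.hasFDerivWithinAt_curveIntegral_segment_of_hasFDerivWithinAt_symmetric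
    (fun w _ => (hasFDerivAt_blockForm (P := P) hh w).hasFDerivWithinAt)
    (fun w _ u _ v _ => by simpa using hclosed w v u) (Set.mem_univ z₀) (Set.mem_univ z)
  rw [hasFDerivWithinAt_univ] at key
  simpa only [← linePotential_eq_curveIntegral hh] using key

/-- Along block `i` the potential grows exactly like `h i`, so that `h i - linePotential` does not
depend on that block. -/
theorem sub_linePotential_eq (hP : CompleteOrthogonalIdempotents P)
    (hh : ∀ i, ContDiff ℝ 2 (h i))
    (hsym : ∀ i j z u v, fderiv ℝ (fderiv ℝ (h i)) z (P j v) (P i u)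
      = fderiv ℝ (fderiv ℝ (h j)) z (P j v) (P i u)) (z₀ : E) (i : ι) {z z' : E}
    (hz : P i (z - z') = z - z') :
    h i z - linePotential P h z₀ z = h i z' - linePotential P h z₀ z' := by
  classical
  have hderiv (w : E) : HasFDerivAt (fun w => h i w - linePotential P h z₀ w)
      (fderiv ℝ (h i) w - blockForm P h w) w :=
    ((hh i).differentiable (by simp) w).hasFDerivAt.sub
      (hasFDerivAt_linePotential hP hh hsym z₀ w)
  have hzero (w : E) : (fderiv ℝ (h i) w - blockForm P h w) (z - z') = 0 := by
    have hproj (j : ι) : P j (z - z') = if j = i then z - z' else 0 := by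
      rw [← hz]
      split_ifs with hj
      · rw [hj, hz, hz]
      · simpa using congrArg (fun L : E →L[ℝ] E => L (z - z')) (hP.ortho hj)
    simp only [blockForm, sub_apply, sum_apply,
      ContinuousLinearMap.comp_apply, hproj]
    rw [Finset.sum_eq_single i (fun j _ hj => by simp [hj]) (by simp)]
    simp
  have hline (r : ℝ) : HasDerivAt
      (fun r : ℝ => h i (z' + r • (z - z')) - linePotential P h z₀ (z' + r • (z - z'))) 0 r := by
    have hl : HasDerivAt (fun r : ℝ => z' + r • (z - z')) (z - z') r := by
      simpa using ((hasDerivAt_id r).smul_const (z - z')).const_add z'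
    have := (hderiv (z' + r • (z - z'))).comp_hasDerivAt r hl
    rwa [hzero] at this
  have := is_const_of_deriv_eq_zero (fun r => (hline r).differentiableAt)
    (fun r => (hline r).deriv) 1 0
  simpa using this

/-- A derivative is the limit of difference quotients, so no regularity in the parameter beyond
measurability is needed. -/
theorem measurable_fderiv_apply_of_measurable {S : Type*} [MeasurableSpace S] [MeasurableSpace E]
    [BorelSpace E] [SecondCountableTopology E] {h : S → E → ℝ}
    (hm : Measurable fun p : S × E => h p.1 p.2) (hd : ∀ s, Differentiable ℝ (h s)) :
    Measurable fun p : S × E × E => fderiv ℝ (h p.1) p.2.1 p.2.2 := by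
  refine measurable_of_tendsto_metrizable (f := fun (m : ℕ) (p : S × E × E) =>
    ((m : ℝ) + 1) * (h p.1 (p.2.1 + ((m : ℝ) + 1)⁻¹ • p.2.2) - h p.1 p.2.1)) (fun m => ?_) ?_
  · have h₁ : Measurable fun p : S × E × E => h p.1 (p.2.1 + ((m : ℝ) + 1)⁻¹ • p.2.2) :=
      hm.comp (measurable_fst.prodMk
        (measurable_snd.fst.add (measurable_snd.snd.const_smul _)))
    have h₂ : Measurable fun p : S × E × E => h p.1 p.2.1 :=
      hm.comp (measurable_fst.prodMk measurable_snd.fst)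
    exact (h₁.sub h₂).const_mul _
  · rw [tendsto_pi_nhds]
    rintro ⟨s, z, v⟩
    have hlim : Tendsto (fun m : ℕ => ‖((m : ℝ) + 1)‖) atTop atTop := by
      have : Tendsto (fun m : ℕ => (m : ℝ) + 1) atTop atTop :=
        tendsto_atTop_add_const_right _ _ tendsto_natCast_atTop_atTop
      exact tendsto_norm_atTop_atTop.comp this
    exact (hd s z).hasFDerivAt.lim v hlim

theorem measurable_linePotential {S : Type*} [MeasurableSpace S] [MeasurableSpace E]
    [BorelSpace E] [SecondCountableTopology E] {h : ι → S → E → ℝ}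
    (hm : ∀ i, Measurable fun p : S × E => h i p.1 p.2)
    (hd : ∀ i s, Differentiable ℝ (h i s)) (z₀ : E) :
    Measurable fun p : S × E => linePotential P (fun i => h i p.1) z₀ p.2 := by
  unfold linePotential
  refine Finset.measurable_sum _ fun i _ => ?_
  simp only [intervalIntegral.integral_of_le zero_le_one]
  have hmeas : Measurable fun q : (S × E) × ℝ =>
      fderiv ℝ (h i q.1.1) (z₀ + q.2 • (q.1.2 - z₀)) (P i (q.1.2 - z₀)) :=
    (measurable_fderiv_apply_of_measurable (hm i) (hd i)).comp
      (measurable_fst.fst.prodMk (Measurable.prodMk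
        ((measurable_snd.smul (measurable_fst.snd.sub_const _)).const_add _)
        ((P i).measurable.comp (measurable_fst.snd.sub_const _))))
  exact hmeas.stronglyMeasurable.integral_prod_right.measurable

/-- A block derivative of linear growth makes the potential grow quadratically. The constant depends
on `h` only through the growth constant `C`. -/
theorem abs_linePotential_le {C : ℝ} (hC : 0 ≤ C)
    (hgrowth : ∀ i z v, |fderiv ℝ (h i) z (P i v)| ≤ C * (1 + ‖z‖) * ‖v‖) (z₀ z : E) :
    |linePotential P h z₀ z|
      ≤ Fintype.card ι * C * (2 * (1 + 2 * ‖z₀‖) ^ 2) * (1 + ‖z‖ ^ 2) := by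
  have hi (i : ι) : |∫ r in (0 : ℝ)..1, fderiv ℝ (h i) (z₀ + r • (z - z₀)) (P i (z - z₀))|
      ≤ C * (1 + 2 * ‖z₀‖ + ‖z‖) ^ 2 := by
    have hsub : ‖z - z₀‖ ≤ ‖z‖ + ‖z₀‖ := norm_sub_le _ _
    have := intervalIntegral.norm_integral_le_of_norm_le_const (a := (0 : ℝ)) (b := 1)
      (f := fun r => fderiv ℝ (h i) (z₀ + r • (z - z₀)) (P i (z - z₀)))
      (C := C * (1 + 2 * ‖z₀‖ + ‖z‖) ^ 2) (fun r hr => ?_)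
    · simpa using this
    · rw [Set.uIoc_of_le zero_le_one] at hr
      have hr' : ‖z₀ + r • (z - z₀)‖ ≤ 2 * ‖z₀‖ + ‖z‖ := by
        have h₁ : ‖r • (z - z₀)‖ ≤ ‖z - z₀‖ := by
          rw [norm_smul, Real.norm_of_nonneg hr.1.le]
          exact mul_le_of_le_one_left (norm_nonneg _) hr.2
        linarith [norm_add_le z₀ (r • (z - z₀))]
      calc ‖fderiv ℝ (h i) (z₀ + r • (z - z₀)) (P i (z - z₀))‖
          ≤ C * (1 + ‖z₀ + r • (z - z₀)‖) * ‖z - z₀‖ := hgrowth _ _ _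
        _ ≤ C * (1 + 2 * ‖z₀‖ + ‖z‖) * (1 + 2 * ‖z₀‖ + ‖z‖) := by
            refine mul_le_mul (mul_le_mul_of_nonneg_left (by linarith) hC)
              (by linarith [norm_nonneg z₀]) (norm_nonneg _) (by positivity)
        _ = C * (1 + 2 * ‖z₀‖ + ‖z‖) ^ 2 := by ring
  calc |linePotential P h z₀ z|
      ≤ ∑ i : ι, C * (1 + 2 * ‖z₀‖ + ‖z‖) ^ 2 :=
        (Finset.abs_sum_le_sum_abs _ _).trans (Finset.sum_le_sum fun i _ => hi i)
    _ = Fintype.card ι * C * (1 + 2 * ‖z₀‖ + ‖z‖) ^ 2 := by simp [mul_assoc]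
    _ ≤ Fintype.card ι * C * (2 * (1 + 2 * ‖z₀‖) ^ 2 * (1 + ‖z‖ ^ 2)) := by
        gcongr
        have h₁ : 1 ≤ (1 + 2 * ‖z₀‖) ^ 2 := one_le_pow₀ (by linarith [norm_nonneg z₀])
        nlinarith [sq_nonneg (1 + 2 * ‖z₀‖ - ‖z‖), sq_nonneg ‖z‖]
    _ = _ := by ring

end LinePotential

/-! ### Partial derivatives of functions of a profile -/

section Profiles

variable {N : ℕ} {d : Fin N → ℕ}

/-- The projection of a profile onto its `i`-th block. -/
def blockProj (d : Fin N → ℕ) (i : Fin N) : (∀ j, Vec (d j)) →L[ℝ] (∀ j, Vec (d j)) :=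
  (ContinuousLinearMap.single ℝ (fun j => Vec (d j)) i).comp (ContinuousLinearMap.proj i)

@[simp]
theorem blockProj_apply (i : Fin N) (x : ∀ j, Vec (d j)) :
    blockProj d i x = Pi.single i (x i) := rfl

theorem completeOrthogonalIdempotents_blockProj :
    CompleteOrthogonalIdempotents (blockProj d) where
  idem i := by
    refine ContinuousLinearMap.ext fun x => ?_
    simp
  ortho i j hij := by
    refine ContinuousLinearMap.ext fun x => ?_
    simp [Pi.single_eq_of_ne hij]
  complete := by
    refine ContinuousLinearMap.ext fun x => ?_
    simpa using Finset.univ_sum_single x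

theorem hasFDerivAt_update_single (x : ∀ j, Vec (d j)) (i : Fin N) (y : Vec (d i)) :
    HasFDerivAt (Function.update x i)
      (ContinuousLinearMap.single ℝ (fun j => Vec (d j)) i) y := by
  refine (hasFDerivAt_update x y).congr_fderiv (ContinuousLinearMap.ext fun w => funext fun j => ?_)
  rcases eq_or_ne j i with rfl | hj
  · simp
  · simp [hj]

theorem inner_partialGrad {h : (∀ j, Vec (d j)) → ℝ} {x : ∀ j, Vec (d j)}
    {h' : (∀ j, Vec (d j)) →L[ℝ] ℝ} (hh : HasFDerivAt h h' x) (i : Fin N) (v : Vec (d i)) :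
    inner ℝ (partialGrad i h x) v = h' (Pi.single i v) := by
  have hu : HasFDerivAt (fun y => h (Function.update x i y))
      (h'.comp (ContinuousLinearMap.single ℝ (fun j => Vec (d j)) i)) (x i) := by
    refine HasFDerivAt.comp (x i) (g := h) (by simpa using hh) ?_
    exact hasFDerivAt_update_single x i (x i)
  rw [partialGrad, gradient, InnerProductSpace.toDual_symm_apply, hu.fderiv]
  rfl

theorem partialDeriv_apply {m : ℕ} {h : (∀ j, Vec (d j)) → Vec m} {x : ∀ j, Vec (d j)}
    {h' : (∀ j, Vec (d j)) →L[ℝ] Vec m} (hh : HasFDerivAt h h' x) (j : Fin N) (v : Vec (d j)) :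
    partialDeriv j h x v = h' (Pi.single j v) := by
  have hu : HasFDerivAt (fun y => h (Function.update x j y))
      (h'.comp (ContinuousLinearMap.single ℝ (fun j => Vec (d j)) j)) (x j) := by
    refine HasFDerivAt.comp (x j) (g := h) (by simpa using hh) ?_
    exact hasFDerivAt_update_single x j (x j)
  rw [partialDeriv, hu.fderiv]
  rfl

/-- If `φ` is the gradient of a twice differentiable `H` in the directions `range κ`, evaluated along
`ρ`, then its partial derivatives are blocks of the second derivative of `H`. -/
theorem inner_partialDeriv {E : Type*} [NormedAddCommGroup E] [NormedSpace ℝ E] {m : ℕ}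
    {H : E → ℝ} (hH : ContDiff ℝ 2 H) (κ : Vec m →L[ℝ] E) {ρ : (∀ j, Vec (d j)) → E}
    {ρ' : (∀ j, Vec (d j)) →L[ℝ] E} {x : ∀ j, Vec (d j)} (hρ : HasFDerivAt ρ ρ' x)
    {φ : (∀ j, Vec (d j)) → Vec m} (hφ : ∀ y u, inner ℝ (φ y) u = fderiv ℝ H (ρ y) (κ u))
    (j : Fin N) (v : Vec (d j)) (u : Vec m) :
    inner ℝ (partialDeriv j φ x v) u
      = fderiv ℝ (fderiv ℝ H) (ρ x) (ρ' (Pi.single j v)) (κ u) := by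
  have hd : HasFDerivAt (fderiv ℝ H) (fderiv ℝ (fderiv ℝ H) (ρ x)) (ρ x) :=
    (((hH.fderiv_right (m := 1) (by norm_num)).differentiable (by simp)) _).hasFDerivAt
  have hinner (u : Vec m) : HasFDerivAt (fun y => inner ℝ (φ y) u)
      (((ContinuousLinearMap.apply ℝ ℝ (κ u)).comp (fderiv ℝ (fderiv ℝ H) (ρ x))).comp ρ') x := by
    simp only [hφ]
    exact ((ContinuousLinearMap.apply ℝ ℝ (κ u)).hasFDerivAt.comp (ρ x) hd).comp x hρ
  -- The coordinates of `φ` are inner products with unit vectors.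
  have hdiff : DifferentiableAt ℝ φ x := by
    refine (differentiableAt_euclidean (𝕜 := ℝ)).2 fun c => ?_
    have := (hinner (EuclideanSpace.single c 1)).differentiableAt
    simpa [EuclideanSpace.inner_single_right] using this
  rw [partialDeriv_apply hdiff.hasFDerivAt]
  have hder : HasFDerivAt (fun y => inner ℝ (φ y) u)
      ((innerSL ℝ u).comp (fderiv ℝ φ x)) x := by
    have := (innerSL ℝ u).hasFDerivAt.comp x hdiff.hasFDerivAt
    refine this.congr_of_eventuallyEq (Eventually.of_forall fun y => ?_)
    simp [real_inner_comm]
  have := congrArg (fun L : (∀ j, Vec (d j)) →L[ℝ] ℝ => L (Pi.single j v))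
    (hder.unique (hinner u))
  simpa [real_inner_comm] using this

/-- Completes a profile of the others by the block `x₀ i`. -/
def fillBlock (i : Fin N) (x₀ : ∀ j, Vec (d j)) (y : ∀ j : {j : Fin N // j ≠ i}, Vec (d j)) :
    ∀ j, Vec (d j) :=
  fun j => if hj : j = i then x₀ j else y ⟨j, hj⟩

theorem measurable_fillBlock (i : Fin N) (x₀ : ∀ j, Vec (d j)) : Measurable (fillBlock i x₀) := by
  refine measurable_pi_lambda _ fun j => ?_
  by_cases hj : j = i
  · simp [fillBlock, hj]
  · simpa [fillBlock, hj] using measurable_pi_apply _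

theorem blockProj_sub_fillBlock (i : Fin N) (x₀ x : ∀ j, Vec (d j)) :
    blockProj d i (x - fillBlock i x₀ (others i x)) = x - fillBlock i x₀ (others i x) := by
  funext j
  rcases eq_or_ne j i with rfl | hj
  · simp
  · simp [fillBlock, others, hj]

theorem norm_sq_le_sum (x : ∀ j, Vec (d j)) : ‖x‖ ^ 2 ≤ ∑ j, ‖x j‖ ^ 2 := by
  have hnn : 0 ≤ ∑ j, ‖x j‖ ^ 2 := Finset.sum_nonneg fun _ _ => sq_nonneg _
  rw [← Real.le_sqrt (norm_nonneg _) hnn, pi_norm_le_iff_of_nonneg (Real.sqrt_nonneg _)]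
  intro j
  rw [Real.le_sqrt (norm_nonneg _) hnn]
  exact Finset.single_le_sum (f := fun j => ‖x j‖ ^ 2) (fun _ _ => sq_nonneg _) (Finset.mem_univ j)

variable {n k : Fin N → ℕ}

/-- The projection of a state-action profile onto the state and action of agent `i`. -/
def pairProj (n k : Fin N → ℕ) (i : Fin N) :
    ((∀ j, Vec (n j)) × (∀ j, Vec (k j))) →L[ℝ] ((∀ j, Vec (n j)) × (∀ j, Vec (k j))) :=
  (blockProj n i).prodMap (blockProj k i)

@[simp]
theorem pairProj_apply (i : Fin N) (z : (∀ j, Vec (n j)) × (∀ j, Vec (k j))) :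
    pairProj n k i z = (blockProj n i z.1, blockProj k i z.2) := rfl

theorem completeOrthogonalIdempotents_pairProj :
    CompleteOrthogonalIdempotents (pairProj n k) where
  idem i := by
    refine ContinuousLinearMap.ext fun x => ?_
    simp
  ortho i j hij := by
    refine ContinuousLinearMap.ext fun x => ?_
    simp [Pi.single_eq_of_ne hij]
  complete := by
    refine ContinuousLinearMap.ext fun x => ?_
    refine Prod.ext ?_ ?_
    · simpa [Prod.fst_sum] using Finset.univ_sum_single x.1
    · simpa [Prod.snd_sum] using Finset.univ_sum_single x.2

section Pair

variable {h : (∀ j, Vec (n j)) → (∀ j, Vec (k j)) → ℝ}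

theorem inner_partialGrad_state (hh : Differentiable ℝ (Function.uncurry h)) (i : Fin N)
    (x : ∀ j, Vec (n j)) (a : ∀ j, Vec (k j)) (v : Vec (n i)) :
    inner ℝ (partialGrad i (fun y => h y a) x) v
      = fderiv ℝ (Function.uncurry h) (x, a) (Pi.single i v, 0) := by
  have hl := (hh (x, a)).hasFDerivAt.comp x (hasFDerivAt_prodMk_left (𝕜 := ℝ) x a)
  exact (inner_partialGrad hl i v).trans (by simp)

theorem inner_partialGrad_action (hh : Differentiable ℝ (Function.uncurry h)) (i : Fin N)
    (x : ∀ j, Vec (n j)) (a : ∀ j, Vec (k j)) (v : Vec (k i)) :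
    inner ℝ (partialGrad i (fun c => h x c) a) v
      = fderiv ℝ (Function.uncurry h) (x, a) (0, Pi.single i v) := by
  have hr := (hh (x, a)).hasFDerivAt.comp a (hasFDerivAt_prodMk_right (𝕜 := ℝ) x a)
  exact (inner_partialGrad hr i v).trans (by simp)

theorem fderiv_pairProj (hh : Differentiable ℝ (Function.uncurry h)) (i : Fin N)
    (z v : (∀ j, Vec (n j)) × (∀ j, Vec (k j))) :
    fderiv ℝ (Function.uncurry h) z (pairProj n k i v)
      = inner ℝ (partialGrad i (fun y => h y z.2) z.1) (v.1 i)
        + inner ℝ (partialGrad i (fun c => h z.1 c) z.2) (v.2 i) := by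
  rw [inner_partialGrad_state hh, inner_partialGrad_action hh, ← map_add]
  simp

/-- The block of the second derivative belonging to agents `j` and `i`, in terms of the four
partial Hessians. -/
theorem fderiv_fderiv_pairProj (hh : ContDiff ℝ 2 (Function.uncurry h)) (i j : Fin N)
    (z u v : (∀ j, Vec (n j)) × (∀ j, Vec (k j))) :
    fderiv ℝ (fderiv ℝ (Function.uncurry h)) z (pairProj n k j v) (pairProj n k i u)
      = inner ℝ (hessXX i j h z.1 z.2 (v.1 j)) (u.1 i)
        + inner ℝ (hessAX i j h z.1 z.2 (v.1 j)) (u.2 i)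
        + inner ℝ (hessXA i j h z.1 z.2 (v.2 j)) (u.1 i)
        + inner ℝ (hessAA i j h z.1 z.2 (v.2 j)) (u.2 i) := by
  have hd := hh.differentiable (by simp)
  let κx : Vec (n i) →L[ℝ] (∀ j, Vec (n j)) × (∀ j, Vec (k j)) :=
    (ContinuousLinearMap.inl ℝ _ _).comp (ContinuousLinearMap.single ℝ (fun j => Vec (n j)) i)
  let κa : Vec (k i) →L[ℝ] (∀ j, Vec (n j)) × (∀ j, Vec (k j)) :=
    (ContinuousLinearMap.inr ℝ _ _).comp (ContinuousLinearMap.single ℝ (fun j => Vec (k j)) i)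
  have hx := hasFDerivAt_prodMk_left (𝕜 := ℝ) z.1 z.2
  have ha := hasFDerivAt_prodMk_right (𝕜 := ℝ) z.1 z.2
  rw [hessXX, hessAX, hessXA, hessAA,
    inner_partialDeriv hh κx hx (fun y w => inner_partialGrad_state hd i y z.2 w),
    inner_partialDeriv hh κa hx (fun y w => inner_partialGrad_action hd i y z.2 w),
    inner_partialDeriv hh κx ha (fun y w => inner_partialGrad_state hd i z.1 y w),
    inner_partialDeriv hh κa ha (fun y w => inner_partialGrad_action hd i z.1 y w)]
  have hv : pairProj n k j v = ContinuousLinearMap.inl ℝ _ _ (Pi.single j (v.1 j))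
      + ContinuousLinearMap.inr ℝ _ _ (Pi.single j (v.2 j)) := by simp
  have hu : pairProj n k i u = κx (u.1 i) + κa (u.2 i) := by simp [κx, κa]
  rw [hv, hu]
  simp only [map_add, add_apply]
  ring

end Pair

end Profiles

/-! ### The decomposition of the costs -/

namespace DistributedGame

variable {N nw : ℕ} {n k : Fin N → ℕ} {T : ℝ} (D : DistributedGame N nw n k T)

theorem potentialF_eq_linePotential (hf : ∀ i t, Differentiable ℝ (Function.uncurry (D.f i t)))
    (x₀ : ∀ j, Vec (n j)) (a₀ : ∀ j, Vec (k j)) (t : Time T) (x : ∀ j, Vec (n j))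
    (a : ∀ j, Vec (k j)) :
    D.potentialF x₀ a₀ t x a
      = linePotential (pairProj n k) (fun i => Function.uncurry (D.f i t)) (x₀, a₀) (x, a) := by
  refine Finset.sum_congr rfl fun i _ => intervalIntegral.integral_congr fun r _ => ?_
  have := fderiv_pairProj (hf i t) i ((x₀, a₀) + r • ((x, a) - (x₀, a₀))) ((x, a) - (x₀, a₀))
  simp only [Prod.fst_add, Prod.snd_add, Prod.smul_fst, Prod.smul_snd, Prod.fst_sub, Prod.snd_sub,
    Pi.sub_apply] at this
  exact this.symm

theorem potentialG_eq_linePotential (hg : ∀ i, Differentiable ℝ (D.g i))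
    (x₀ x : ∀ j, Vec (n j)) :
    D.potentialG x₀ x = linePotential (blockProj n) D.g x₀ x := by
  refine Finset.sum_congr rfl fun i _ => intervalIntegral.integral_congr fun r _ => ?_
  exact inner_partialGrad (hg i _).hasFDerivAt i _

/-- If `f i - F` and `g i - G` do not change when block `i` is reset to the base point, then they
are functions of the other blocks, and freezing block `i` exhibits them as measurable such
functions. -/
theorem isCostDecomposition_of_sub_eq
    {F : Time T → (∀ j, Vec (n j)) → (∀ j, Vec (k j)) → ℝ} {G : (∀ j, Vec (n j)) → ℝ}
    (x₀ : ∀ j, Vec (n j)) (a₀ : ∀ j, Vec (k j))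
    (hF : Measurable fun p : Time T × (∀ j, Vec (n j)) × (∀ j, Vec (k j)) => F p.1 p.2.1 p.2.2)
    (hG : Measurable G)
    (hf : ∀ i t x a, D.f i t x a - F t x a
      = D.f i t (fillBlock i x₀ (others i x)) (fillBlock i a₀ (others i a))
        - F t (fillBlock i x₀ (others i x)) (fillBlock i a₀ (others i a)))
    (hg : ∀ i x, D.g i x - G x
      = D.g i (fillBlock i x₀ (others i x)) - G (fillBlock i x₀ (others i x))) :
    D.IsCostDecomposition F G := by
  refine ⟨hF, hG,
    fun i t y b => D.f i t (fillBlock i x₀ y) (fillBlock i a₀ b)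
      - F t (fillBlock i x₀ y) (fillBlock i a₀ b),
    fun i y => D.g i (fillBlock i x₀ y) - G (fillBlock i x₀ y),
    fun i => ?_, fun i => ?_, fun i t x a => ?_, fun i x => ?_⟩
  · have hfill : Measurable fun p : Time T × (∀ j : {j : Fin N // j ≠ i}, Vec (n j)) ×
        (∀ j : {j : Fin N // j ≠ i}, Vec (k j)) =>
        (p.1, fillBlock i x₀ p.2.1, fillBlock i a₀ p.2.2) :=
      measurable_fst.prodMk (((measurable_fillBlock i x₀).comp measurable_snd.fst).prodMk
        ((measurable_fillBlock i a₀).comp measurable_snd.snd))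
    exact ((D.f_measurable i).comp hfill).sub (hF.comp hfill)
  · exact ((D.g_measurable i).sub hG).comp (measurable_fillBlock i x₀)
  · linarith [hf i t x a]
  · linarith [hg i x]

theorem isCostDecomposition_potential (hf : ∀ i t, ContDiff ℝ 2 (Function.uncurry (D.f i t)))
    (hg : ∀ i, ContDiff ℝ 2 (D.g i))
    (hsymf : ∀ i j t x a,
      hessXX i j (D.f i t) x a = hessXX i j (D.f j t) x a ∧
      hessAX i j (D.f i t) x a = hessAX i j (D.f j t) x a ∧
      hessXA i j (D.f i t) x a = hessXA i j (D.f j t) x a ∧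
      hessAA i j (D.f i t) x a = hessAA i j (D.f j t) x a)
    (hsymg : ∀ i j x, partialDeriv j (partialGrad i (D.g i)) x
      = partialDeriv j (partialGrad i (D.g j)) x)
    (x₀ : ∀ j, Vec (n j)) (a₀ : ∀ j, Vec (k j)) :
    D.IsCostDecomposition (D.potentialF x₀ a₀) (D.potentialG x₀) := by
  have hfd i t := (hf i t).differentiable (by simp)
  have hgd i := (hg i).differentiable (by simp)
  have hF : Measurable fun p : Time T × (∀ j, Vec (n j)) × (∀ j, Vec (k j)) =>
      D.potentialF x₀ a₀ p.1 p.2.1 p.2.2 := by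
    simp only [D.potentialF_eq_linePotential hfd]
    exact measurable_linePotential D.f_measurable hfd (x₀, a₀)
  have hG : Measurable (D.potentialG x₀) := by
    have := (measurable_linePotential (P := blockProj n) (S := Unit) (h := fun i _ => D.g i)
      (fun i => (D.g_measurable i).comp measurable_snd) (fun i _ => hgd i) x₀).comp
      (measurable_prodMk_left (x := ()))
    rw [funext (D.potentialG_eq_linePotential hgd x₀)]
    exact this
  have hpair (t : Time T) i j (z u v : (∀ j, Vec (n j)) × (∀ j, Vec (k j))) :
      fderiv ℝ (fderiv ℝ (Function.uncurry (D.f i t))) z (pairProj n k j v) (pairProj n k i u)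
        = fderiv ℝ (fderiv ℝ (Function.uncurry (D.f j t))) z (pairProj n k j v) (pairProj n k i u) := by
    obtain ⟨h₁, h₂, h₃, h₄⟩ := hsymf i j t z.1 z.2
    rw [fderiv_fderiv_pairProj (hf i t), fderiv_fderiv_pairProj (hf j t),
      h₁, h₂, h₃, h₄]
  have hblock i j (z u v : ∀ j, Vec (n j)) :
      fderiv ℝ (fderiv ℝ (D.g i)) z (blockProj n j v) (blockProj n i u)
        = fderiv ℝ (fderiv ℝ (D.g j)) z (blockProj n j v) (blockProj n i u) := by
    have key l : inner ℝ (partialDeriv j (partialGrad i (D.g l)) z (v j)) (u i)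
        = fderiv ℝ (fderiv ℝ (D.g l)) z (blockProj n j v) (blockProj n i u) :=
      inner_partialDeriv (hg l) (ContinuousLinearMap.single ℝ (fun j => Vec (n j)) i)
        (hasFDerivAt_id z) (φ := partialGrad i (D.g l))
        (fun y w => inner_partialGrad (hgd l y).hasFDerivAt i w) j (v j) (u i)
    rw [← key, ← key, hsymg]
  refine D.isCostDecomposition_of_sub_eq x₀ a₀ hF hG (fun i t x a => ?_) (fun i x => ?_)
  · have := sub_linePotential_eq completeOrthogonalIdempotents_pairProj (fun i => hf i t)
      (hpair t) (x₀, a₀) i (z := (x, a))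
      (z' := (fillBlock i x₀ (others i x), fillBlock i a₀ (others i a)))
      (Prod.ext (blockProj_sub_fillBlock i x₀ x) (blockProj_sub_fillBlock i a₀ a))
    rw [D.potentialF_eq_linePotential hfd, D.potentialF_eq_linePotential hfd]
    exact this
  · have := sub_linePotential_eq completeOrthogonalIdempotents_blockProj hg hblock x₀ i
      (blockProj_sub_fillBlock i x₀ x)
    simpa only [D.potentialG_eq_linePotential hgd] using this

theorem potential_growth (hf : ∀ i t, Differentiable ℝ (Function.uncurry (D.f i t)))
    (hg : ∀ i, Differentiable ℝ (D.g i))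
    (hgrowth : ∀ i, ∃ C : ℝ, ∀ t x a,
      ‖partialGrad i (fun y => D.f i t y a) x‖ + ‖partialGrad i (fun c => D.f i t x c) a‖
        + ‖partialGrad i (D.g i) x‖ ≤ C * (1 + ‖x‖ + ‖a‖))
    (x₀ : ∀ j, Vec (n j)) (a₀ : ∀ j, Vec (k j)) :
    ∃ C : ℝ, ∀ t x a, |D.potentialF x₀ a₀ t x a| + |D.potentialG x₀ x|
      ≤ C * (1 + ‖x‖ ^ 2 + ‖a‖ ^ 2) := by
  choose c hc using hgrowth
  obtain ⟨M, hM⟩ := Finite.exists_le c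
  set K := max M 0
  have hK : 0 ≤ K := le_max_right _ _
  have hcK i : c i ≤ K := (hM i).trans (le_max_left _ _)
  have hF (t : Time T) i (z v : (∀ j, Vec (n j)) × (∀ j, Vec (k j))) :
      |fderiv ℝ (Function.uncurry (D.f i t)) z (pairProj n k i v)| ≤ 2 * K * (1 + ‖z‖) * ‖v‖ := by
    rw [fderiv_pairProj (hf i t)]
    have h₁ := abs_real_inner_le_norm (partialGrad i (fun y => D.f i t y z.2) z.1) (v.1 i)
    have h₂ := abs_real_inner_le_norm (partialGrad i (fun b => D.f i t z.1 b) z.2) (v.2 i)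
    have hv₁ : ‖v.1 i‖ ≤ ‖v‖ := (norm_le_pi_norm v.1 i).trans (norm_fst_le v)
    have hv₂ : ‖v.2 i‖ ≤ ‖v‖ := (norm_le_pi_norm v.2 i).trans (norm_snd_le v)
    calc _ ≤ ‖partialGrad i (fun y => D.f i t y z.2) z.1‖ * ‖v‖
          + ‖partialGrad i (fun b => D.f i t z.1 b) z.2‖ * ‖v‖ :=
          (abs_add_le _ _).trans (add_le_add (h₁.trans (by gcongr)) (h₂.trans (by gcongr)))
      _ ≤ (c i * (1 + ‖z.1‖ + ‖z.2‖)) * ‖v‖ := by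
          rw [← add_mul]
          gcongr
          linarith [hc i t z.1 z.2, norm_nonneg (partialGrad i (D.g i) z.1)]
      _ ≤ (K * (2 * (1 + ‖z‖))) * ‖v‖ := by
          gcongr
          · exact hcK i
          · linarith [norm_fst_le z, norm_snd_le z]
      _ = _ := by ring
  have hG i (z v : ∀ j, Vec (n j)) :
      |fderiv ℝ (D.g i) z (blockProj n i v)| ≤ K * (1 + ‖z‖) * ‖v‖ := by
    rw [blockProj_apply, ← inner_partialGrad (hg i z).hasFDerivAt]
    refine (abs_real_inner_le_norm _ _).trans ?_
    gcongr
    -- The bound on `∂g` does not involve `t` and `a`; `a = 0` removes `‖a‖` from it.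
    · have h := hc i D.terminal z 0
      rw [norm_zero, add_zero] at h
      calc _ ≤ c i * (1 + ‖z‖) := by
            linarith [norm_nonneg (partialGrad i (fun y => D.f i D.terminal y 0) z),
              norm_nonneg (partialGrad i (fun b => D.f i D.terminal z b) 0)]
        _ ≤ _ := by
            gcongr
            exact hcK i
    · exact norm_le_pi_norm v i
  refine ⟨Fintype.card (Fin N) * (2 * K) * (2 * (1 + 2 * ‖(x₀, a₀)‖) ^ 2)
    + Fintype.card (Fin N) * K * (2 * (1 + 2 * ‖x₀‖) ^ 2), fun t x a => ?_⟩
  rw [D.potentialF_eq_linePotential hf, D.potentialG_eq_linePotential hg, add_mul]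
  have hxa : ‖(x, a)‖ ^ 2 ≤ ‖x‖ ^ 2 + ‖a‖ ^ 2 := by
    rcases max_cases ‖x‖ ‖a‖ with h | h <;>
      · rw [Prod.norm_mk, h.1]
        nlinarith [sq_nonneg ‖x‖, sq_nonneg ‖a‖]
  refine add_le_add ((abs_linePotential_le (by positivity) (hF t) _ _).trans ?_)
    ((abs_linePotential_le hK hG _ _).trans ?_)
  · exact mul_le_mul_of_nonneg_left (by linarith) (by positivity)
  · exact mul_le_mul_of_nonneg_left (by linarith [sq_nonneg ‖a‖]) (by positivity)

end DistributedGame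

/-! ### Integrability of costs of quadratic growth -/

namespace DistributedGame

universe u

variable {N nw : ℕ} {n k : Fin N → ℕ} {T : ℝ} {D : DistributedGame N nw n k T}
  {Ω : Type u} [MeasurableSpace Ω] {P : Measure Ω} {W : Time T → Ω → Vec nw}

instance isFiniteMeasure_timeMeasure : IsFiniteMeasure (timeMeasure T) where
  measure_univ_lt_top := by
    rw [timeMeasure, comap_subtype_coe_apply measurableSet_Icc, Set.image_univ, Subtype.range_coe]
    exact measure_Icc_lt_top

namespace SolvesState

variable {i : Fin N} {φ : Time T → Vec (n i) → Vec (k i)} {t : Time T} {x : Vec (n i)}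
  {X : Time T → Ω → Vec (n i)}

theorem measurable (hX : D.SolvesState P W i φ t x X) {s : Time T} (hs : t ≤ s) :
    Measurable (X s) := by
  obtain ⟨⟨𝔽, -, hadapted, -⟩, -⟩ := hX
  exact (hadapted s hs).mono (𝔽.le s) le_rfl

/-- Only times `s ≥ t` matter; freezing the process at `X t` before `t` makes its paths continuous
on the whole interval, hence the process jointly measurable. -/
theorem measurable_uncurry_max (hX : D.SolvesState P W i φ t x X) :
    Measurable fun p : Ω × Time T => X (max t p.2) p.1 := by
  have hm : Measurable (Function.uncurry fun (s : Time T) ω => X (max t s) ω) := by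
    refine measurable_uncurry_of_continuous_of_measurable (fun ω => ?_)
      fun s => hX.measurable (le_max_left t s)
    obtain ⟨⟨𝔽, -, -, hcont, -⟩, -⟩ := hX
    exact (hcont ω).comp_continuous (continuous_const.max continuous_id) fun s => le_max_left t s
  exact hm.comp measurable_swap

theorem lintegral_enorm_sq_le {s : Time T} (hs : t ≤ s) :
    ∫⁻ ω, ‖X s ω‖ₑ ^ 2 ∂P ≤ ∫⁻ ω, ⨆ s : Set.Ici t, ‖X (s : Time T) ω‖ₑ ^ 2 ∂P :=
  lintegral_mono fun ω => le_iSup (fun s : Set.Ici t => ‖X (s : Time T) ω‖ₑ ^ 2) ⟨s, hs⟩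

theorem integrable_norm_sq (hX : D.SolvesState P W i φ t x X) {s : Time T} (hs : t ≤ s) :
    Integrable (fun ω => ‖X s ω‖ ^ 2) P := by
  refine ⟨((hX.measurable hs).norm.pow_const 2).aestronglyMeasurable, ?_⟩
  simpa [HasFiniteIntegral, enorm_pow] using (lintegral_enorm_sq_le hs).trans_lt hX.2

theorem integrable_norm_sq_prod [SFinite P] (hX : D.SolvesState P W i φ t x X)
    (ν : Measure (Time T)) [IsFiniteMeasure ν] :
    Integrable (fun p : Ω × Time T => ‖X (max t p.2) p.1‖ ^ 2) (P.prod ν) := by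
  have hm := hX.measurable_uncurry_max
  refine ⟨(hm.norm.pow_const 2).aestronglyMeasurable, ?_⟩
  simp only [HasFiniteIntegral, enorm_pow, enorm_norm]
  rw [lintegral_prod_symm _ (hm.enorm.pow_const 2).aemeasurable]
  calc ∫⁻ s, ∫⁻ ω, ‖X (max t s) ω‖ₑ ^ 2 ∂P ∂ν
      ≤ ∫⁻ _, (∫⁻ ω, ⨆ s : Set.Ici t, ‖X (s : Time T) ω‖ₑ ^ 2 ∂P) ∂ν :=
        lintegral_mono fun s => lintegral_enorm_sq_le (le_max_left t s)
    _ < ∞ := by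
        rw [lintegral_const]
        exact ENNReal.mul_lt_top hX.2 (measure_lt_top ν _)

end SolvesState

/-- A feedback policy of linear growth turns quadratic growth in the state-action pair into
quadratic growth in the state alone. -/
theorem exists_norm_sq_control_le (φ : ∀ j, D.Policy P W j) :
    ∃ K : ℝ, 0 ≤ K ∧ ∀ r (y : ∀ j, Vec (n j)),
      ‖fun j => (φ j).1 r (y j)‖ ^ 2 ≤ K * (1 + ∑ j, ‖y j‖ ^ 2) := by
  choose c hc using fun j => (φ j).2.growth
  refine ⟨∑ j, 2 * c j ^ 2, Finset.sum_nonneg fun j _ => by positivity, fun r y => ?_⟩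
  rw [Finset.sum_mul]
  refine (norm_sq_le_sum _).trans (Finset.sum_le_sum fun j _ => ?_)
  have hj : ‖y j‖ ^ 2 ≤ ∑ j, ‖y j‖ ^ 2 :=
    Finset.single_le_sum (f := fun j => ‖y j‖ ^ 2) (fun _ _ => sq_nonneg _) (Finset.mem_univ j)
  calc ‖(φ j).1 r (y j)‖ ^ 2 ≤ (c j * (1 + ‖y j‖)) ^ 2 :=
        pow_le_pow_left₀ (norm_nonneg _) (hc j r (y j)) 2
    _ = c j ^ 2 * (1 + ‖y j‖) ^ 2 := mul_pow _ _ _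
    _ ≤ c j ^ 2 * (2 * (1 + ∑ j, ‖y j‖ ^ 2)) := by
        gcongr
        nlinarith [sq_nonneg (1 - ‖y j‖)]
    _ = 2 * c j ^ 2 * (1 + ∑ j, ‖y j‖ ^ 2) := by ring

namespace StateProcesses

theorem integrableCost_of_growth [IsFiniteMeasure P] (𝒳 : D.StateProcesses P W)
    {h : Time T → (∀ j, Vec (n j)) → (∀ j, Vec (k j)) → ℝ} {q : (∀ j, Vec (n j)) → ℝ}
    (hh : Measurable fun p : Time T × (∀ j, Vec (n j)) × (∀ j, Vec (k j)) => h p.1 p.2.1 p.2.2)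
    (hq : Measurable q)
    (hgrowth : ∃ C : ℝ, ∀ t x a, |h t x a| + |q x| ≤ C * (1 + ‖x‖ ^ 2 + ‖a‖ ^ 2))
    (s : Time T × (∀ j, Vec (n j))) (φ : ∀ j, D.Policy P W j) : 𝒳.IntegrableCost h q s φ := by
  obtain ⟨C, hC⟩ := hgrowth
  obtain ⟨K, hK, hφ⟩ := exists_norm_sq_control_le φ
  have hX j := 𝒳.solves j (φ j) s.1 (s.2 j)
  have hC0 : 0 ≤ C := by
    have := hC s.1 0 0
    simp only [norm_zero] at this
    linarith [abs_nonneg (h s.1 0 0), abs_nonneg (q 0)]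
  have hbound (r : Time T) (y : ∀ j, Vec (n j)) :
      |h r y fun j => (φ j).1 r (y j)| + |q y| ≤ C * (1 + K) * (1 + ∑ j, ‖y j‖ ^ 2) := by
    refine (hC _ _ _).trans ?_
    rw [mul_assoc]
    refine mul_le_mul_of_nonneg_left ?_ hC0
    linarith [norm_sq_le_sum y, hφ r y]
  refine ⟨?_, ?_⟩
  · set ν := (timeMeasure T).restrict (Set.Ici s.1)
    have hY : Measurable fun p : Ω × Time T => fun j => 𝒳.X j (φ j) s.1 (s.2 j) (max s.1 p.2) p.1 :=
      measurable_pi_lambda _ fun j => (hX j).measurable_uncurry_max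
    have hα : Measurable fun p : Ω × Time T => fun j =>
        (φ j).1 p.2 (𝒳.X j (φ j) s.1 (s.2 j) (max s.1 p.2) p.1) :=
      measurable_pi_lambda _ fun j =>
        (φ j).2.measurable.comp (measurable_snd.prodMk (hX j).measurable_uncurry_max)
    have hdom : Integrable (fun p : Ω × Time T => C * (1 + K) *
        (1 + ∑ j, ‖𝒳.X j (φ j) s.1 (s.2 j) (max s.1 p.2) p.1‖ ^ 2)) (P.prod ν) :=
      ((integrable_const 1).add (integrable_finsetSum _ fun j _ =>
        (hX j).integrable_norm_sq_prod ν)).const_mul _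
    have hint := hdom.mono' (hh.comp (measurable_snd.prodMk (hY.prodMk hα))).aestronglyMeasurable
      (Eventually.of_forall fun p =>
        (le_add_of_nonneg_right (abs_nonneg _)).trans (hbound p.2 _))
    refine hint.congr ?_
    -- Freezing the process before the initial time changes nothing on `[t, T]`.
    have hae : ∀ᵐ r ∂ν, s.1 ≤ r := ae_restrict_mem measurableSet_Ici
    filter_upwards [Measure.quasiMeasurePreserving_snd.ae hae] with p hp
    simp only [Function.comp_apply, max_eq_right hp]
    rfl
  · have hle : s.1 ≤ D.terminal := s.1.2.2
    have hY : Measurable fun ω => 𝒳.state s φ D.terminal ω :=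
      measurable_pi_lambda _ fun j => (hX j).measurable hle
    have hdom : Integrable (fun ω => C * (1 + K) *
        (1 + ∑ j, ‖𝒳.X j (φ j) s.1 (s.2 j) D.terminal ω‖ ^ 2)) P :=
      ((integrable_const 1).add (integrable_finsetSum _ fun j _ =>
        (hX j).integrable_norm_sq hle)).const_mul _
    exact hdom.mono' (hq.comp hY).aestronglyMeasurable (Eventually.of_forall fun ω =>
      (le_add_of_nonneg_left (abs_nonneg _)).trans (hbound D.terminal _))

/-! ### The potential identity -/

theorem expectedCost_sub [SFinite P] (𝒳 : D.StateProcesses P W)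
    {h h' : Time T → (∀ j, Vec (n j)) → (∀ j, Vec (k j)) → ℝ} {q q' : (∀ j, Vec (n j)) → ℝ}
    {s : Time T × (∀ j, Vec (n j))} {φ : ∀ j, D.Policy P W j}
    (hint : 𝒳.IntegrableCost h q s φ) (hint' : 𝒳.IntegrableCost h' q' s φ) :
    𝒳.expectedCost h q s φ - 𝒳.expectedCost h' q' s φ
      = 𝒳.expectedCost (fun t x a => h t x a - h' t x a) (fun x => q x - q' x) s φ := by
  refine (integral_sub (hint.1.integral_prod_left.add hint.2)
    (hint'.1.integral_prod_left.add hint'.2)).symm.trans (integral_congr_ae ?_)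
  filter_upwards [hint.1.prod_right_ae, hint'.1.prod_right_ae] with ω hω hω'
  simp only [Pi.add_apply]
  rw [integral_sub hω hω']
  ring

/-- The difference between an agent's cost and the common cost is driven by the others' states and
actions only, and in a distributed game these do not react to the agent's own policy. -/
theorem isPotentialFunction_expectedCost [SFinite P] (𝒳 : D.StateProcesses P W)
    {F : Time T → (∀ j, Vec (n j)) → (∀ j, Vec (k j)) → ℝ} {G : (∀ j, Vec (n j)) → ℝ}
    (hdec : D.IsCostDecomposition F G)
    (hcost : ∀ i s φ, 𝒳.IntegrableCost (D.f i) (D.g i) s φ)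
    (hpot : ∀ s φ, 𝒳.IntegrableCost F G s φ) :
    IsPotentialFunction 𝒳.value (𝒳.expectedCost F G) := by
  obtain ⟨-, -, Uf, Ug, -, -, hf, hg⟩ := hdec
  intro s i φ ψ
  have hdiff (φ : ∀ j, D.Policy P W j) : 𝒳.value i s φ - 𝒳.expectedCost F G s φ
      = 𝒳.expectedCost (fun t x a => Uf i t (others i x) (others i a))
        (fun x => Ug i (others i x)) s φ := by
    rw [value, 𝒳.expectedCost_sub (hcost i s φ) (hpot s φ)]
    simp only [hf, hg, add_sub_cancel_left]
  have hx (r : Time T) (ω : Ω) : others i (𝒳.state s (Function.update φ i ψ) r ω)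
      = others i (𝒳.state s φ r ω) := by
    funext j
    simp only [others, state, Function.update_of_ne j.2]
  have ha (r : Time T) (ω : Ω) : others i (𝒳.control s (Function.update φ i ψ) r ω)
      = others i (𝒳.control s φ r ω) := by
    funext j
    simp only [others, control, Function.update_of_ne j.2]
  have hinv := hdiff (Function.update φ i ψ)
  simp only [expectedCost, hx, ha] at hinv
  have h := hdiff φ
  simp only [expectedCost] at h ⊢
  linarith

end StateProcesses

end DistributedGame

end DistGame

end

theorem theorem3p3 {N nw : ℕ} {n k : Fin N → ℕ} {T : ℝ}
    (D : DistGame.DistributedGame N nw n k T)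
    {Ω : Type*} [MeasurableSpace Ω] (P : Measure Ω) [IsProbabilityMeasure P]
    (W : DistGame.Time T → Ω → DistGame.Vec nw)
    (hW : ∃ 𝔽 : Filtration (DistGame.Time T) ‹MeasurableSpace Ω›, DistGame.IsBrownianMotion P 𝔽 W)
    (𝒳 : D.StateProcesses P W)
    (hf : ∀ i t, ContDiff ℝ 2
      fun p : (∀ j, DistGame.Vec (n j)) × (∀ j, DistGame.Vec (k j)) => D.f i t p.1 p.2)
    (hg : ∀ i, ContDiff ℝ 2 (D.g i))
    (hgrowth : ∀ i, ∃ C : ℝ, ∀ t x a,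
      ‖DistGame.partialGrad i (fun y => D.f i t y a) x‖
        + ‖DistGame.partialGrad i (fun c => D.f i t x c) a‖
        + ‖DistGame.partialGrad i (D.g i) x‖ ≤ C * (1 + ‖x‖ + ‖a‖))
    (hsymf : ∀ i j t x a,
      DistGame.hessXX i j (D.f i t) x a = DistGame.hessXX i j (D.f j t) x a ∧
      DistGame.hessAX i j (D.f i t) x a = DistGame.hessAX i j (D.f j t) x a ∧
      DistGame.hessXA i j (D.f i t) x a = DistGame.hessXA i j (D.f j t) x a ∧
      DistGame.hessAA i j (D.f i t) x a = DistGame.hessAA i j (D.f j t) x a)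
    (hsymg : ∀ i j x,
      DistGame.partialDeriv j (DistGame.partialGrad i (D.g i)) x
        = DistGame.partialDeriv j (DistGame.partialGrad i (D.g j)) x)
    (x₀ : ∀ j, DistGame.Vec (n j)) (a₀ : ∀ j, DistGame.Vec (k j)) :
    D.IsCostDecomposition (D.potentialF x₀ a₀) (D.potentialG x₀) ∧
    (∀ s φ, (∀ i, 𝒳.IntegrableCost (D.f i) (D.g i) s φ) ∧
      𝒳.IntegrableCost (D.potentialF x₀ a₀) (D.potentialG x₀) s φ) ∧
    DistGame.IsPotentialFunction 𝒳.value
      (𝒳.expectedCost (D.potentialF x₀ a₀) (D.potentialG x₀)) ∧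
    DistGame.IsMarkovPotentialGame 𝒳.value := by
  have hfd i t := (hf i t).differentiable (by simp)
  have hgd i := (hg i).differentiable (by simp)
  have hdec := D.isCostDecomposition_potential hf hg hsymf hsymg x₀ a₀
  have hcost i s φ : 𝒳.IntegrableCost (D.f i) (D.g i) s φ :=
    𝒳.integrableCost_of_growth (D.f_measurable i) (D.g_measurable i) (D.cost_growth i) s φ
  have hpot s φ : 𝒳.IntegrableCost (D.potentialF x₀ a₀) (D.potentialG x₀) s φ :=
    𝒳.integrableCost_of_growth hdec.1 hdec.2.1
      (D.potential_growth hfd hgd hgrowth x₀ a₀) s φ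
  have hΦ := 𝒳.isPotentialFunction_expectedCost hdec hcost hpot
  exact ⟨hdec, fun s φ => ⟨fun i => hcost i s φ, hpot s φ⟩, hΦ, _, hΦ⟩
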